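/- Let $a$, $b$ and $r$ be natural numbers with $1 \le r < ab$. Let $\Omega^{(a^b)}$ be the collection of all set partitions of $\{1,2,\ldots,ab\}$ into $b$ sets each of size $a$, let $H^{(a^b)}$ (the Foulkes module) be the corresponding permutation module for the symmetric group $S_{ab}$ over $\mathbb{C}$, and let $\phi^{(a^b)}$ be its character. Let $\chi^{(ab-r,1^r)}$ be the character of the Specht module $S^{(ab-r,1^r)}$ over $\mathbb{C}$, that is, of the submodule spanned by the polytabloids in the permutation module of $S_{ab}$ on the tabloids of shape $(ab-r,1^r)$. Then $$\left\langle \phi^{(a^b)},\chi^{(ab-r,1^r)}\right\rangle = \frac{1}{(ab)!}\sum_{g \in S_{ab}} \phi^{(a^b)}(g)\,\overline{\chi^{(ab-r,1^r)}(g)} = 0,$$ and no direct summand of $H^{(a^b)}$ is isomorphic to the Specht module $S^{(ab-r,1^r)}$. -/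

import Mathlib

/-! ### Partitions, Young diagrams, tableaux -/

/-- The hook partition `(n - r, 1 ^ r)` of `n`, for `0 ≤ r < n`. -/
def hookPartition (n r : ℕ) (hr : r < n) : n.Partition where
  parts := (n - r) ::ₘ Multiset.replicate r 1
  parts_pos := by
    intro i hi
    rcases Multiset.mem_cons.1 hi with rfl | hi
    · omega
    · rw [Multiset.eq_of_mem_replicate hi]
      exact Nat.one_pos
  parts_sum := by
    simp only [Multiset.sum_cons, Multiset.sum_replicate, smul_eq_mul, mul_one]
    omega

/-- The Young diagram of a partition: the cell `(i, j)` is present when `j` is less than the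
`i`-th largest part (rows and columns are numbered from `0`). -/
def partitionDiagram {n : ℕ} (μ : n.Partition) : YoungDiagram :=
  YoungDiagram.ofRowLens (μ.parts.sort (· ≥ ·)) (μ.parts.pairwise_sort (· ≥ ·)).sortedGE

/-- A `μ`-tableau: a bijective filling of the Young diagram of `μ` by the `n` symbols. -/
def YTableau {n : ℕ} (μ : n.Partition) : Type :=
  {c : ℕ × ℕ // c ∈ partitionDiagram μ} ≃ Fin n

namespace YTableau

variable {n : ℕ} {μ : n.Partition}

/-- The row of the tableau `t` in which the symbol `x` stands. -/
def rowOf (t : YTableau μ) (x : Fin n) : ℕ := (Equiv.symm t x).1.1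

/-- The column of the tableau `t` in which the symbol `x` stands. -/
def colOf (t : YTableau μ) (x : Fin n) : ℕ := (Equiv.symm t x).1.2

/-- The symmetric group acts on tableaux by permuting the entries. -/
instance : MulAction (Equiv.Perm (Fin n)) (YTableau μ) where
  smul g t := Equiv.trans t g
  one_smul _ := rfl
  mul_smul _ _ _ := rfl

theorem rowOf_smul (g : Equiv.Perm (Fin n)) (t : YTableau μ) (x : Fin n) :
    (g • t).rowOf x = t.rowOf (g⁻¹ x) := rfl

theorem colOf_smul (g : Equiv.Perm (Fin n)) (t : YTableau μ) (x : Fin n) :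
    (g • t).colOf x = t.colOf (g⁻¹ x) := rfl

/-- Two tableaux are row equivalent when corresponding rows contain the same symbols. -/
instance rowSetoid (μ : n.Partition) : Setoid (YTableau μ) where
  r s t := ∀ x, s.rowOf x = t.rowOf x
  iseqv := ⟨fun _ _ => rfl, fun h x => (h x).symm, fun h k x => (h x).trans (k x)⟩

/-- The column stabiliser of `t`: the permutations that preserve every column of `t` setwise. -/
def colStabilizer (t : YTableau μ) : Finset (Equiv.Perm (Fin n)) :=
  Finset.univ.filter fun π => ∀ x, t.colOf (π x) = t.colOf x

theorem mem_colStabilizer {t : YTableau μ} {π : Equiv.Perm (Fin n)} :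
    π ∈ t.colStabilizer ↔ ∀ x, t.colOf (π x) = t.colOf x := by
  simp [colStabilizer]

end YTableau

/-! ### Tabloids, polytabloids, Specht modules -/

/-- A `μ`-tabloid: a row equivalence class of `μ`-tableaux. -/
def Tabloid {n : ℕ} (μ : n.Partition) : Type := Quotient (YTableau.rowSetoid μ)

/-- The tabloid of a tableau. -/
def YTableau.tabloid {n : ℕ} {μ : n.Partition} (t : YTableau μ) : Tabloid μ :=
  Quotient.mk (YTableau.rowSetoid μ) t

instance {n : ℕ} (μ : n.Partition) : MulAction (Equiv.Perm (Fin n)) (Tabloid μ) where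
  smul g := Quotient.map (fun t => g • t) fun _ _ h x => h (g⁻¹ x)
  one_smul T := Quotient.inductionOn T fun _ => rfl
  mul_smul _ _ T := Quotient.inductionOn T fun _ => rfl

theorem YTableau.smul_tabloid {n : ℕ} {μ : n.Partition} (g : Equiv.Perm (Fin n))
    (t : YTableau μ) : g • t.tabloid = (g • t).tabloid := rfl

/-- The Young permutation module `M^μ` over `ℂ`, with basis the `μ`-tabloids. -/
noncomputable def youngPermRep {n : ℕ} (μ : n.Partition) :
    Representation ℂ (Equiv.Perm (Fin n)) (MonoidAlgebra ℂ (Tabloid μ)) :=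
  Representation.ofMulAction ℂ (Equiv.Perm (Fin n)) (Tabloid μ)

/-- The polytabloid of `t`: the signed sum of `π • {t}` over the column stabiliser of `t`. -/
noncomputable def polytabloid {n : ℕ} {μ : n.Partition} (t : YTableau μ) :
    MonoidAlgebra ℂ (Tabloid μ) :=
  ∑ π ∈ t.colStabilizer,
    MonoidAlgebra.single (π • t.tabloid) (((Equiv.Perm.sign π : ℤˣ) : ℤ) : ℂ)

theorem youngPermRep_polytabloid {n : ℕ} {μ : n.Partition} (g : Equiv.Perm (Fin n))
    (t : YTableau μ) : youngPermRep μ g (polytabloid t) = polytabloid (g • t) := by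
  unfold polytabloid youngPermRep
  rw [map_sum]
  refine Finset.sum_equiv (MulAut.conj g).toEquiv ?_ ?_
  · intro π
    rw [YTableau.mem_colStabilizer, YTableau.mem_colStabilizer]
    simp only [YTableau.colOf_smul, MulEquiv.toEquiv_eq_coe,
      EquivLike.coe_coe, MulAut.conj_apply]
    constructor
    · intro h x
      simpa using h (g⁻¹ x)
    · intro h x
      simpa using h (g x)
  · intro π _
    rw [Representation.ofMulAction_single]
    simp only [YTableau.smul_tabloid, smul_smul, MulEquiv.toEquiv_eq_coe, MulEquiv.coe_toEquiv,
      MulAut.conj_apply, inv_mul_cancel_right, map_mul, map_inv]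
    rw [mul_right_comm, mul_inv_cancel, one_mul]

/-- The Specht module `S^μ`: the span of the `μ`-polytabloids inside `M^μ`. -/
noncomputable def spechtSub {n : ℕ} (μ : n.Partition) : Subrepresentation (youngPermRep μ) where
  toSubmodule := Submodule.span ℂ (Set.range fun t : YTableau μ => polytabloid t)
  apply_mem_toSubmodule g v hv := by
    induction hv using Submodule.span_induction with
    | mem x hx =>
      obtain ⟨t, rfl⟩ := hx
      exact Submodule.subset_span ⟨g • t, (youngPermRep_polytabloid g t).symm⟩
    | zero => rw [map_zero]; exact Submodule.zero_mem _
    | add x y _ _ hx hy => rw [map_add]; exact Submodule.add_mem _ hx hy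
    | smul c x _ hx => rw [map_smul]; exact Submodule.smul_mem _ c hx

/-- The Specht module `S^μ` as a representation of the symmetric group. -/
noncomputable def spechtRep {n : ℕ} (μ : n.Partition) :
    Representation ℂ (Equiv.Perm (Fin n)) (spechtSub μ).toSubmodule :=
  (spechtSub μ).toRepresentation

/-- The character `χ^μ` of the Specht module `S^μ`. -/
noncomputable def spechtCharacter {n : ℕ} (μ : n.Partition) : Equiv.Perm (Fin n) → ℂ :=
  (spechtRep μ).character

/-! ### Foulkes modules -/

/-- The collection `Ω^{(a^b)}` of set partitions of a set of size `a * b` into `b` sets of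
size `a`. -/
def FoulkesPartition (a b : ℕ) : Type :=
  {P : Finpartition (Finset.univ : Finset (Fin (a * b))) //
    P.parts.card = b ∧ ∀ A ∈ P.parts, A.card = a}

/-- The automorphism of the lattice of subsets induced by a permutation. -/
def permFinsetIso {n : ℕ} (g : Equiv.Perm (Fin n)) : Finset (Fin n) ≃o Finset (Fin n) where
  toEquiv := g.finsetCongr
  map_rel_iff' := Finset.map_subset_map

theorem permFinsetIso_apply {n : ℕ} (g : Equiv.Perm (Fin n)) (A : Finset (Fin n)) :
    permFinsetIso g A = A.image g := 
  Finset.map_eq_image g.toEmbedding A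

theorem permFinsetIso_univ {n : ℕ} (g : Equiv.Perm (Fin n)) :
    permFinsetIso g Finset.univ = Finset.univ :=
  Finset.map_univ_equiv g

/-- A permutation `g` sends the set partition `{A₁, …, A_b}` to `{g(A₁), …, g(A_b)}`. -/
instance (a b : ℕ) : MulAction (Equiv.Perm (Fin (a * b))) (FoulkesPartition a b) where
  smul g P := ⟨(P.1.map (permFinsetIso g)).copy (permFinsetIso_univ g), by
    refine ⟨(Finset.card_map _).trans P.2.1, fun A hA => ?_⟩
    obtain ⟨B, hB, rfl⟩ := Finset.mem_map.1 hA
    exact (Finset.card_map _).trans (P.2.2 B hB)⟩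
  one_smul P := by
    apply Subtype.ext
    apply Finpartition.ext
    change P.1.parts.map (permFinsetIso 1).toEquiv.toEmbedding = P.1.parts
    ext A
    rw [Finset.mem_map]
    change (∃ B ∈ P.1.parts, permFinsetIso 1 B = A) ↔ _
    simp [permFinsetIso_apply]
  mul_smul g h P := by
    apply Subtype.ext
    apply Finpartition.ext
    change P.1.parts.map _ = (P.1.parts.map _).map _
    rw [Finset.map_map]
    congr 1
    apply Function.Embedding.ext
    intro A
    change permFinsetIso (g * h) A = permFinsetIso g (permFinsetIso h A)
    simp only [permFinsetIso_apply, Finset.image_image, Equiv.Perm.coe_mul]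

theorem FoulkesPartition.smul_parts {a b : ℕ} (g : Equiv.Perm (Fin (a * b)))
    (P : FoulkesPartition a b) :
    (g • P).1.parts = P.1.parts.image fun A => A.image g := by
  change P.1.parts.map (permFinsetIso g).toEquiv.toEmbedding = _
  ext A
  rw [Finset.mem_map, Finset.mem_image]
  change (∃ B ∈ P.1.parts, permFinsetIso g B = A) ↔ _
  simp only [permFinsetIso_apply]

/-- The Foulkes module `H^{(a^b)}`: the permutation module over `ℂ` on `Ω^{(a^b)}`. -/
noncomputable def foulkesRep (a b : ℕ) :
    Representation ℂ (Equiv.Perm (Fin (a * b))) (MonoidAlgebra ℂ (FoulkesPartition a b)) :=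
  Representation.ofMulAction ℂ (Equiv.Perm (Fin (a * b))) (FoulkesPartition a b)

/-- The Foulkes character `φ^{(a^b)}`. -/
noncomputable def foulkesCharacter (a b : ℕ) : Equiv.Perm (Fin (a * b)) → ℂ :=
  (foulkesRep a b).character

/-! ### Inner product of characters, direct summands -/

/-- The usual inner product of complex functions on a finite group:
`⟨φ, ψ⟩ = |G|⁻¹ ∑ φ(g) * conj ψ(g)`. -/
noncomputable def charInner {G : Type*} [Group G] [Fintype G] (φ ψ : G → ℂ) : ℂ :=
  (Fintype.card G : ℂ)⁻¹ * ∑ g : G, φ g * (starRingEnd ℂ) (ψ g)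

/-- `σ` is isomorphic to a direct summand of the representation `ρ`. -/
def IsDirectSummand {G V W : Type*} [Group G] [AddCommGroup V] [Module ℂ V]
    [AddCommGroup W] [Module ℂ W]
    (σ : Representation ℂ G W) (ρ : Representation ℂ G V) : Prop :=
  ∃ U U' : Subrepresentation ρ, IsCompl U U' ∧ Nonempty (U.toRepresentation.Equiv σ)

/-! ### Permutation representations without stabiliser-fixed vectors -/

section PermutationRepresentation

variable {G X W : Type*} [Group G] [MulAction G X] [AddCommGroup W] [Module ℂ W]

/-! By Frobenius reciprocity, homomorphisms from a permutation module into `W` correspond to vectors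
of `W` fixed by point stabilisers. Both conclusions therefore follow once no nonzero vector of the
Specht module is fixed by the stabiliser of a set partition `P`
(`eq_zero_of_mem_spechtSub_of_stabilizer_fixed`).

A tabloid of shape `(n - r, 1 ^ r)` is an ordered `r`-tuple of distinct symbols, those below the
first row. Elements of the Specht module are alternating functions of this tuple
(`coeff_swap_of_mem_spechtSub`). If `r ≥ 2`, some permutation stabilising `P` acts on the tuple as a
transposition: swap two symbols in a common part or, if all lie in different parts, interchange two
whole parts. A fixed vector then has each coefficient equal to its negative. If `r = 1`, the
stabiliser is transitive on symbols, so a fixed vector is constant, while its coefficients sum to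
zero. -/

open scoped Classical in
theorem character_ofMulAction [Fintype X] (g : G) :
    (Representation.ofMulAction ℂ G X).character g = ∑ x : X, if g • x = x then 1 else 0 := by
  unfold Representation.character
  rw [← LinearMap.trace_conj' _ (MonoidAlgebra.coeffLinearEquiv ℂ),
    LinearMap.trace_eq_matrix_trace ℂ (Finsupp.basisSingleOne (ι := X)), Matrix.trace]
  refine Finset.sum_congr rfl fun x _ => ?_
  simp [LinearMap.toMatrix_apply, Representation.ofMulAction_def, LinearEquiv.conj_apply,
    Finsupp.single_apply]

/-- Expanding the permutation character as a count of fixed points turns the sum into traces of `∑ σ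
g` over point stabilisers. Each such operator takes values in stabiliser-fixed vectors, hence
vanishes. -/
theorem charInner_ofMulAction_eq_zero [Fintype G] [Finite X] (σ : Representation ℂ G W)
    (h : ∀ (x : X) (w : W), (∀ k : G, k • x = x → σ k w = w) → w = 0) :
    charInner (Representation.ofMulAction ℂ G X).character σ.character = 0 := by
  classical
  have := Fintype.ofFinite X
  have hx (x : X) : ∑ g : G, (if g • x = x then σ g else 0) = 0 := by
    ext w
    refine h x _ fun k hk => ?_
    simp only [LinearMap.sum_apply, map_sum]
    -- Left multiplication by `k` permutes the stabiliser of `x`, so `σ k` only reindexes the sum.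
    refine Fintype.sum_equiv (Equiv.mulLeft k) _ _ fun g => ?_
    have : (k * g) • x = x ↔ g • x = x := by
      rw [mul_smul]
      exact ⟨fun e => MulAction.injective k (e.trans hk.symm), fun e => by rw [e, hk]⟩
    simp only [Equiv.coe_mulLeft, this]
    split_ifs <;> simp
  have key : ∑ g : G, (Representation.ofMulAction ℂ G X).character g * σ.character g = 0 := by
    simp only [character_ofMulAction, Finset.sum_mul]
    rw [Finset.sum_comm]
    refine Finset.sum_eq_zero fun x _ => ?_
    have := congrArg (LinearMap.trace ℂ W) (hx x)
    rw [map_sum, map_zero] at this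
    refine Eq.trans (Finset.sum_congr rfl fun g _ => ?_) this
    split_ifs <;> simp [Representation.character]
  have hreal (g : G) : (starRingEnd ℂ) ((Representation.ofMulAction ℂ G X).character g) =
      (Representation.ofMulAction ℂ G X).character g := by
    simp [character_ofMulAction]
  unfold charInner
  rw [mul_eq_zero]
  right
  -- The permutation character is real, so the wanted sum is the complex conjugate of the one in
  -- `key`.
  rw [← map_zero (starRingEnd ℂ), ← key, map_sum]
  exact Finset.sum_congr rfl fun g _ => by rw [map_mul, hreal]

/-- The component in `U` of a basis vector `x` is fixed by the stabiliser of `x`, hence is zero. So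
`U'` contains every basis vector and `U` is trivial. -/
theorem not_isDirectSummand_ofMulAction [Nontrivial W] (σ : Representation ℂ G W)
    (h : ∀ (x : X) (w : W), (∀ k : G, k • x = x → σ k w = w) → w = 0) :
    ¬ IsDirectSummand σ (Representation.ofMulAction ℂ G X) := by
  rintro ⟨U, U', hU, ⟨e⟩⟩
  have hinf : U.toSubmodule ⊓ U'.toSubmodule = ⊥ :=
    (Subrepresentation.toSubmodule_inf U U').symm.trans (by rw [hU.inf_eq_bot]; rfl)
  have hsup : U.toSubmodule ⊔ U'.toSubmodule = ⊤ :=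
    (Subrepresentation.toSubmodule_sup U U').symm.trans (by rw [hU.sup_eq_top]; rfl)
  have hsingle (x : X) : MonoidAlgebra.single x (1 : ℂ) ∈ U'.toSubmodule := by
    obtain ⟨u, hu, u', hu', huu⟩ := Submodule.mem_sup.1
      (hsup ▸ Submodule.mem_top : MonoidAlgebra.single x (1 : ℂ) ∈ U.toSubmodule ⊔ U'.toSubmodule)
    have hu0 : e ⟨u, hu⟩ = 0 := by
      refine h x _ fun k hk => ?_
      have hfix : Representation.ofMulAction ℂ G X k u = u := by
        have hk' : Representation.ofMulAction ℂ G X k u +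
            Representation.ofMulAction ℂ G X k u' = u + u' := by
          rw [← map_add, huu, Representation.ofMulAction_single, hk]
        -- The displacement of `u` under `k` is the opposite of that of `u'`, so it lies in both
        -- summands.
        rw [← sub_eq_zero, ← Submodule.mem_bot ℂ, ← hinf]
        refine ⟨U.toSubmodule.sub_mem (U.apply_mem_toSubmodule k hu) hu, ?_⟩
        have : Representation.ofMulAction ℂ G X k u - u =
            u' - Representation.ofMulAction ℂ G X k u' := by
          rw [sub_eq_sub_iff_add_eq_add, hk', add_comm]
        rw [this]
        exact U'.toSubmodule.sub_mem hu' (U'.apply_mem_toSubmodule k hu')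
      have := e.toIntertwiningMap.isIntertwining _ _ k (⟨u, hu⟩ : U.toSubmodule)
      refine this.symm.trans ?_
      exact congrArg e (Subtype.ext hfix)
    have hu1 : (⟨u, hu⟩ : U.toSubmodule) = 0 :=
      e.toLinearEquiv.injective (hu0.trans (map_zero e.toLinearEquiv).symm)
    rw [← huu, show u = 0 from congrArg Subtype.val hu1, zero_add]
    exact hu'
  have htop : U'.toSubmodule = ⊤ := by
    rw [eq_top_iff]
    intro v _
    induction v using MonoidAlgebra.induction_linear with
    | zero => exact zero_mem _
    | add f g hf hg => exact add_mem (hf trivial) (hg trivial)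
    | single x c =>
      have := U'.toSubmodule.smul_mem c (hsingle x)
      simpa using this
  rw [htop, inf_top_eq] at hinf
  obtain ⟨w, hw⟩ := exists_ne (0 : W)
  obtain ⟨⟨u, hu⟩, rfl⟩ := e.toLinearEquiv.surjective w
  apply hw
  have : u = 0 := by simpa [hinf] using hu
  subst this
  exact map_zero e.toLinearEquiv

end PermutationRepresentation

/-! ### Permutations stabilising a set partition -/

namespace FoulkesPartition

variable {a b : ℕ}

theorem smul_eq_of_image_mem (P : FoulkesPartition a b) (k : Equiv.Perm (Fin (a * b)))
    (h : ∀ A ∈ P.1.parts, A.image k ∈ P.1.parts) : k • P = P := by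
  apply Subtype.ext
  apply Finpartition.ext
  rw [smul_parts]
  refine Finset.eq_of_subset_of_card_le (Finset.image_subset_iff.2 h) ?_
  rw [Finset.card_image_of_injective _ (Finset.image_injective k.injective)]

theorem exists_stabilizer_swap (P : FoulkesPartition a b) {x y : Fin (a * b)} (hxy : x ≠ y) :
    ∃ k : Equiv.Perm (Fin (a * b)), k • P = P ∧ k x = y ∧ k y = x ∧
      ((P.1.part x = P.1.part y ∧ k = Equiv.swap x y) ∨
        P.1.part x ≠ P.1.part y ∧ ∀ z, z ∉ P.1.part x → z ∉ P.1.part y → k z = z) := by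
  have hx := P.1.mem_part (Finset.mem_univ x)
  have hy := P.1.mem_part (Finset.mem_univ y)
  have hX := P.1.part_mem.2 (Finset.mem_univ x)
  have hY := P.1.part_mem.2 (Finset.mem_univ y)
  have hdisj : ∀ A ∈ P.1.parts, ∀ B ∈ P.1.parts, A ≠ B → Disjoint A B :=
    fun A hA B hB hAB => P.1.disjoint hA hB hAB
  have hcard := (P.2.2 _ hX).trans (P.2.2 _ hY).symm
  by_cases hpart : P.1.part x = P.1.part y
  · refine ⟨Equiv.swap x y, smul_eq_of_image_mem P _ fun A hA => ?_, Equiv.swap_apply_left _ _,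
      Equiv.swap_apply_right _ _, Or.inl ⟨hpart, rfl⟩⟩
    have : A.image (Equiv.swap x y) = A := by
      refine Finset.eq_of_subset_of_card_le (Finset.image_subset_iff.2 fun z hz => ?_)
        (Finset.card_image_of_injective _ (Equiv.injective _)).ge
      by_cases hA' : A = P.1.part x
      · rw [Equiv.swap_apply_def]
        split_ifs
        · rw [hA', hpart]; exact hy
        · rw [hA']; exact hx
        · exact hz
      · have hd := hdisj A hA _ hX hA'
        rw [Equiv.swap_apply_of_ne_of_ne]
        · exact hz
        · rintro rfl; exact Finset.disjoint_left.1 hd hz hx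
        · rintro rfl; exact Finset.disjoint_left.1 hd hz (hpart ▸ hy)
    rwa [this]
  · generalize P.1.part x = X at *
    generalize P.1.part y = Y at *
    have hXY := hdisj X hX Y hY hpart
    obtain ⟨e, he⟩ : ∃ e : X ≃ Y, e ⟨x, hx⟩ = ⟨y, hy⟩ := by
      let e := Finset.equivOfCardEq hcard
      -- An arbitrary bijection between the parts is corrected by a transposition so that `x` goes
      -- to `y`.
      exact ⟨e.trans (Equiv.swap (e ⟨x, hx⟩) ⟨y, hy⟩), by simp⟩
    let f : Fin (a * b) → Fin (a * b) := fun z =>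
      if hz : z ∈ X then e ⟨z, hz⟩ else if hz : z ∈ Y then e.symm ⟨z, hz⟩ else z
    have fX (z) (hz : z ∈ X) : f z = e ⟨z, hz⟩ := dif_pos hz
    have fY (z) (hz : z ∈ Y) : f z = e.symm ⟨z, hz⟩ := by
      simp only [f, dif_neg (Finset.disjoint_right.1 hXY hz), dif_pos hz]
    have fN (z) (hz : z ∉ X) (hz' : z ∉ Y) : f z = z := by
      simp only [f, dif_neg hz, dif_neg hz']
    have hf : Function.Involutive f := by
      intro z
      by_cases hz : z ∈ X
      · rw [fX z hz, fY _ (e ⟨z, hz⟩).2]; simp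
      · by_cases hz' : z ∈ Y
        · rw [fY z hz', fX _ (e.symm ⟨z, hz'⟩).2]; simp
        · rw [fN z hz hz', fN z hz hz']
    have hk : f x = y := by rw [fX x hx, he]
    refine ⟨hf.toPerm, smul_eq_of_image_mem P _ fun A hA => ?_, hk, by
      rw [← hk]; exact hf x, Or.inr ⟨hpart, fN⟩⟩
    change A.image f ∈ _
    have hsub (A B : Finset (Fin (a * b))) (hA : A ∈ P.1.parts) (hB : B ∈ P.1.parts)
        (h : ∀ z ∈ A, f z ∈ B) : A.image f ∈ P.1.parts := by
      have : A.image f = B := Finset.eq_of_subset_of_card_le (Finset.image_subset_iff.2 h) <| by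
        rw [Finset.card_image_of_injective _ hf.injective, P.2.2 A hA, P.2.2 B hB]
      rwa [this]
    by_cases hAX : A = X
    · subst hAX
      exact hsub A Y hA hY fun z hz => by rw [fX z hz]; exact (e ⟨z, hz⟩).2
    · by_cases hAY : A = Y
      · subst hAY
        exact hsub A X hA hX fun z hz => by rw [fY z hz]; exact (e.symm ⟨z, hz⟩).2
      · refine hsub A A hA hA fun z hz => ?_
        rwa [fN z (Finset.disjoint_left.1 (hdisj A hA X hX hAX) hz)
          (Finset.disjoint_left.1 (hdisj A hA Y hY hAY) hz)]

theorem exists_stabilizer_swap_fixing (P : FoulkesPartition a b) (S : Set (Fin (a * b)))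
    (hS : S.Nontrivial) :
    ∃ x ∈ S, ∃ y ∈ S, x ≠ y ∧ ∃ k : Equiv.Perm (Fin (a * b)), k • P = P ∧
      ∀ z ∈ S, k z = Equiv.swap x y z := by
  by_cases h : ∃ x ∈ S, ∃ y ∈ S, x ≠ y ∧ P.1.part x = P.1.part y
  · obtain ⟨x, hx, y, hy, hxy, hp⟩ := h
    obtain ⟨k, hk, hkx, hky, ⟨-, rfl⟩ | ⟨hne, -⟩⟩ := exists_stabilizer_swap P hxy
    · exact ⟨x, hx, y, hy, hxy, _, hk, fun _ _ => rfl⟩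
    · exact absurd hp hne
  · push Not at h
    obtain ⟨x, hx, y, hy, hxy⟩ := hS
    obtain ⟨k, hk, hkx, hky, ⟨hp, -⟩ | ⟨-, hkz⟩⟩ := exists_stabilizer_swap P hxy
    · exact absurd hp (h x hx y hy hxy)
    · refine ⟨x, hx, y, hy, hxy, k, hk, fun z hz => ?_⟩
      rw [Equiv.swap_apply_def]
      split_ifs with h1 h2
      · rw [h1, hkx]
      · rw [h2, hky]
      -- All symbols of `S` lie in different parts here, so interchanging the parts of `x` and `y`
      -- leaves the rest of `S` fixed.
      · refine hkz z (fun hz' => ?_) (fun hz' => ?_)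
        · exact h z hz x hx h1 (P.1.part_eq_of_mem (P.1.part_mem.2 (Finset.mem_univ x)) hz')
        · exact h z hz y hy h2 (P.1.part_eq_of_mem (P.1.part_mem.2 (Finset.mem_univ y)) hz')

end FoulkesPartition

/-! ### Specht modules of hook shape -/

theorem mem_partitionDiagram_hookPartition {n r : ℕ} (hr : r < n) {i j : ℕ} :
    (i, j) ∈ partitionDiagram (hookPartition n r hr) ↔
      i = 0 ∧ j < n - r ∨ (1 ≤ i ∧ i ≤ r) ∧ j = 0 := by
  have hsort : (hookPartition n r hr).parts.sort (· ≥ ·) = (n - r) :: List.replicate r 1 := by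
    change Multiset.sort ((n - r) ::ₘ Multiset.replicate r 1) _ = _
    rw [← Multiset.coe_replicate, Multiset.cons_coe, Multiset.coe_sort]
    refine List.mergeSort_of_pairwise ?_
    simp only [decide_eq_true_eq, List.pairwise_cons, List.mem_replicate]
    refine ⟨fun x hx => ?_, ?_⟩
    · omega
    · rw [List.pairwise_replicate]
      simp
  unfold partitionDiagram
  rw [YoungDiagram.mem_ofRowLens]
  simp only [hsort]
  cases i with
  | zero => simp
  | succ i => simp

instance (n r : ℕ) (hr : r < n) : Nonempty (YTableau (hookPartition n r hr)) := by
  have hcells : (partitionDiagram (hookPartition n r hr)).cells =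
      (Finset.range (n - r)).image (fun j => (0, j)) ∪
        (Finset.Icc 1 r).image (fun i => (i, 0)) := by
    ext ⟨i, j⟩
    rw [YoungDiagram.mem_cells, mem_partitionDiagram_hookPartition]
    simp only [Finset.mem_union, Finset.mem_image, Finset.mem_range, Finset.mem_Icc,
      Prod.mk.injEq]
    constructor
    · rintro (⟨rfl, hj⟩ | ⟨hi, rfl⟩)
      · exact Or.inl ⟨j, hj, rfl, rfl⟩
      · exact Or.inr ⟨i, hi, rfl, rfl⟩
    · rintro (⟨_, hj, rfl, rfl⟩ | ⟨_, hi, rfl, rfl⟩)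
      · exact Or.inl ⟨rfl, hj⟩
      · exact Or.inr ⟨hi, rfl⟩
  have hcard : (partitionDiagram (hookPartition n r hr)).cells.card = n := by
    rw [hcells, Finset.card_union_of_disjoint, Finset.card_image_of_injective,
      Finset.card_image_of_injective, Finset.card_range, Nat.card_Icc]
    · omega
    · intro i j h; simpa using h
    · intro i j h; simpa using h
    · rw [Finset.disjoint_left]
      rintro ⟨i, j⟩
      simp only [Finset.mem_image, Finset.mem_range, Finset.mem_Icc, Prod.mk.injEq]
      grind
  exact ⟨Finset.equivFinOfCardEq hcard⟩

/-! ### Coefficients of polytabloids -/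

namespace YTableau

variable {n : ℕ} {μ : n.Partition}

theorem tabloid_eq_iff {s t : YTableau μ} : s.tabloid = t.tabloid ↔ ∀ x, s.rowOf x = t.rowOf x :=
  Quotient.eq

theorem eq_of_rowOf_eq_of_colOf_eq (t : YTableau μ) {x y : Fin n} (hrow : t.rowOf x = t.rowOf y)
    (hcol : t.colOf x = t.colOf y) : x = y :=
  (Equiv.symm t).injective (Subtype.ext (Prod.ext hrow hcol))

theorem exists_rowOf_eq_colOf_eq (t : YTableau μ) {i j : ℕ} (h : (i, j) ∈ partitionDiagram μ) :
    ∃ x, t.rowOf x = i ∧ t.colOf x = j := by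
  refine ⟨Equiv.toFun t ⟨(i, j), h⟩, ?_, ?_⟩
  · exact congrArg (fun c => c.1.1) (Equiv.symm_apply_apply t ⟨(i, j), h⟩)
  · exact congrArg (fun c => c.1.2) (Equiv.symm_apply_apply t ⟨(i, j), h⟩)

theorem swap_mul_mem_colStabilizer {t : YTableau μ} {π : Equiv.Perm (Fin n)}
    (hπ : π ∈ t.colStabilizer) {x y : Fin n} (hxy : t.colOf x = t.colOf y) :
    Equiv.swap x y * π ∈ t.colStabilizer := by
  rw [mem_colStabilizer] at hπ ⊢
  intro z
  rw [Equiv.Perm.mul_apply, ← hπ z, Equiv.swap_apply_def]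
  split_ifs with h1 h2
  · rw [h1, hxy]
  · rw [h2, hxy]
  · rfl

open scoped Classical in
theorem coeff_polytabloid (t : YTableau μ) (T : Tabloid μ) :
    (polytabloid t).coeff T = ∑ π ∈ t.colStabilizer with π • t.tabloid = T,
      (((Equiv.Perm.sign π : ℤˣ) : ℤ) : ℂ) := by
  simp [polytabloid, MonoidAlgebra.coeff_sum, Finsupp.finsetSum_apply, Finsupp.single_apply,
    Finset.sum_filter]

/-- A permutation preserving both the rows and the columns of `t` is the identity. This makes
polytabloids, and so Specht modules, nonzero. -/
theorem coeff_polytabloid_self (t : YTableau μ) : (polytabloid t).coeff t.tabloid = 1 := by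
  classical
  rw [coeff_polytabloid, Finset.sum_eq_single_of_mem 1]
  · simp
  · simp [mem_colStabilizer]
  · intro π hπ h1
    rw [Finset.mem_filter, mem_colStabilizer, smul_tabloid, tabloid_eq_iff] at hπ
    refine absurd (Equiv.ext fun x => ?_) h1
    refine t.eq_of_rowOf_eq_of_colOf_eq ?_ (hπ.1 x)
    have := hπ.2 (π x)
    rw [rowOf_smul, ← Equiv.Perm.mul_apply, inv_mul_cancel, Equiv.Perm.one_apply] at this
    exact this.symm

theorem sum_sign_colStabilizer_eq_zero (t : YTableau μ) {x y : Fin n} (hxy : x ≠ y)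
    (hcol : t.colOf x = t.colOf y) :
    ∑ π ∈ t.colStabilizer, (((Equiv.Perm.sign π : ℤˣ) : ℤ) : ℂ) = 0 := by
  refine Finset.sum_involution (fun π _ => Equiv.swap x y * π) ?_ ?_ ?_ ?_
  · intro π _
    simp [Equiv.Perm.sign_swap hxy]
  · intro π _ _ h
    exact hxy (Equiv.swap_eq_one_iff.1 (mul_eq_right.1 h))
  · exact fun π hπ => swap_mul_mem_colStabilizer hπ hcol
  · intro π _
    rw [← mul_assoc, Equiv.swap_mul_self, one_mul]

end YTableau

instance {n : ℕ} (μ : n.Partition) : Finite (Tabloid μ) := by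
  have : Finite {c : ℕ × ℕ // c ∈ partitionDiagram μ} :=
    inferInstanceAs (Finite (partitionDiagram μ).cells)
  have : Finite (YTableau μ) :=
    inferInstanceAs (Finite ({c : ℕ × ℕ // c ∈ partitionDiagram μ} ≃ Fin n))
  exact inferInstanceAs (Finite (Quotient _))

instance (n r : ℕ) (hr : r < n) : Nontrivial (spechtSub (hookPartition n r hr)).toSubmodule := by
  obtain ⟨t⟩ : Nonempty (YTableau (hookPartition n r hr)) := inferInstance
  refine ⟨⟨polytabloid t, Submodule.subset_span ⟨t, rfl⟩⟩, 0, fun h => ?_⟩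
  have := t.coeff_polytabloid_self
  rw [show polytabloid t = 0 from congrArg Subtype.val h] at this
  simp at this

/-! ### Alternation and coefficient sums for hooks -/

section Hook

variable {n r : ℕ} {hr : r < n}

theorem colOf_eq_zero_of_one_le_rowOf (t : YTableau (hookPartition n r hr)) {x : Fin n}
    (hx : 1 ≤ t.rowOf x) : t.colOf x = 0 := by
  have := (mem_partitionDiagram_hookPartition hr).1 (Equiv.symm t x).2
  change t.rowOf x = 0 ∧ t.colOf x < n - r ∨ (1 ≤ t.rowOf x ∧ t.rowOf x ≤ r) ∧ t.colOf x = 0 at this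
  omega

theorem rowOf_le (t : YTableau (hookPartition n r hr)) (x : Fin n) : t.rowOf x ≤ r := by
  have := (mem_partitionDiagram_hookPartition hr).1 (Equiv.symm t x).2
  change t.rowOf x = 0 ∧ t.colOf x < n - r ∨ (1 ≤ t.rowOf x ∧ t.rowOf x ≤ r) ∧ t.colOf x = 0 at this
  omega

theorem exists_rowOf_eq (t : YTableau (hookPartition n r hr)) {i : ℕ} (hi : i ≤ r) :
    ∃ x, t.rowOf x = i ∧ t.colOf x = 0 :=
  t.exists_rowOf_eq_colOf_eq ((mem_partitionDiagram_hookPartition hr).2 (by omega))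

theorem eq_of_rowOf_eq (t : YTableau (hookPartition n r hr)) {x y : Fin n}
    (hx : 1 ≤ t.rowOf x) (hxy : t.rowOf x = t.rowOf y) : x = y :=
  t.eq_of_rowOf_eq_of_colOf_eq hxy (by
    rw [colOf_eq_zero_of_one_le_rowOf t hx, colOf_eq_zero_of_one_le_rowOf t (hxy ▸ hx)])

/-- Left multiplication by the transposition matches the terms of the two coefficients and reverses
signs. It stays in the column stabiliser because, whenever some `π` there carries the tabloid of `t`
to that of `s`, the lower symbols of `s` all lie in the first column of `t`. -/
theorem coeff_polytabloid_swap (t s : YTableau (hookPartition n r hr)) {x y : Fin n} (hxy : x ≠ y)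
    (hx : 1 ≤ s.rowOf x) (hy : 1 ≤ s.rowOf y) :
    (polytabloid t).coeff (Equiv.swap x y • s.tabloid) = -(polytabloid t).coeff s.tabloid := by
  classical
  rw [YTableau.coeff_polytabloid, YTableau.coeff_polytabloid, ← Finset.sum_neg_distrib]
  have hswap (s' : YTableau (hookPartition n r hr)) (hx' : 1 ≤ s'.rowOf x) (hy' : 1 ≤ s'.rowOf y)
      (π : Equiv.Perm (Fin n))
      (hπ : π ∈ t.colStabilizer.filter fun π => π • t.tabloid = s'.tabloid) :
      Equiv.swap x y * π ∈
        t.colStabilizer.filter fun π => π • t.tabloid = Equiv.swap x y • s'.tabloid := by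
    rw [Finset.mem_filter] at hπ ⊢
    refine ⟨YTableau.swap_mul_mem_colStabilizer hπ.1 ?_, by rw [mul_smul, hπ.2]⟩
    have hcol (z : Fin n) (hz : 1 ≤ s'.rowOf z) : t.colOf z = 0 := by
      have h := hπ.2
      rw [YTableau.smul_tabloid, YTableau.tabloid_eq_iff] at h
      have h0 := YTableau.mem_colStabilizer.1 hπ.1 (π⁻¹ z)
      rw [← Equiv.Perm.mul_apply, mul_inv_cancel, Equiv.Perm.one_apply] at h0
      rw [h0]
      refine colOf_eq_zero_of_one_le_rowOf t ?_
      rw [← YTableau.rowOf_smul, h z]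
      exact hz
    rw [hcol x hx', hcol y hy']
  refine Finset.sum_nbij' (Equiv.swap x y * ·) (Equiv.swap x y * ·) (fun π hπ => ?_)
    (fun π hπ => hswap s hx hy π hπ) ?_ ?_ ?_
  · have hinv : (Equiv.swap x y)⁻¹ = Equiv.swap x y := Equiv.swap_inv x y
    have := hswap (Equiv.swap x y • s)
      (by rwa [YTableau.rowOf_smul, hinv, Equiv.swap_apply_left])
      (by rwa [YTableau.rowOf_smul, hinv, Equiv.swap_apply_right]) π hπ
    rwa [← YTableau.smul_tabloid, smul_smul, Equiv.swap_mul_self, one_smul] at this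
  · intro π _
    simp [← mul_assoc]
  · intro π _
    simp [← mul_assoc]
  · intro π _
    simp [Equiv.Perm.sign_swap hxy]

theorem coeff_swap_of_mem_spechtSub {f : MonoidAlgebra ℂ (Tabloid (hookPartition n r hr))}
    (hf : f ∈ (spechtSub (hookPartition n r hr)).toSubmodule)
    (s : YTableau (hookPartition n r hr)) {x y : Fin n} (hxy : x ≠ y)
    (hx : 1 ≤ s.rowOf x) (hy : 1 ≤ s.rowOf y) :
    f.coeff (Equiv.swap x y • s.tabloid) = -f.coeff s.tabloid := by
  induction hf using Submodule.span_induction with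
  | mem f hf =>
    obtain ⟨t, rfl⟩ := hf
    exact coeff_polytabloid_swap t s hxy hx hy
  | zero => simp
  | add f g _ _ hf hg => simp only [MonoidAlgebra.coeff_add, Finsupp.add_apply, hf, hg]; ring
  | smul c f _ hf => simp only [MonoidAlgebra.coeff_smul, Finsupp.smul_apply, hf, smul_neg]

/-- For a polytabloid this is the sum of signs over a column stabiliser, which cancels in pairs
since `1 ≤ r` puts two symbols in the first column. -/
theorem sum_coeff_of_mem_spechtSub [Fintype (Tabloid (hookPartition n r hr))] (h1 : 1 ≤ r)
    {f : MonoidAlgebra ℂ (Tabloid (hookPartition n r hr))}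
    (hf : f ∈ (spechtSub (hookPartition n r hr)).toSubmodule) : ∑ T, f.coeff T = 0 := by
  induction hf using Submodule.span_induction with
  | mem f hf =>
    classical
    obtain ⟨t, rfl⟩ := hf
    obtain ⟨x, hx, hx'⟩ := exists_rowOf_eq t (Nat.zero_le r)
    obtain ⟨y, hy, hy'⟩ := exists_rowOf_eq t h1
    simp only [YTableau.coeff_polytabloid]
    refine Eq.trans (by convert Finset.sum_fiberwise _ (fun π => π • t.tabloid) _) <|
      t.sum_sign_colStabilizer_eq_zero (by rintro rfl; omega) (hx'.trans hy'.symm)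
  | zero => simp
  | add f g _ _ hf hg =>
    simp only [MonoidAlgebra.coeff_add, Finsupp.add_apply, Finset.sum_add_distrib, hf, hg, add_zero]
  | smul c f _ hf =>
    simp only [MonoidAlgebra.coeff_smul, Finsupp.smul_apply, ← Finset.smul_sum, hf, smul_zero]

end Hook

/-! ### Fixed vectors of set partition stabilisers -/

theorem eq_zero_of_mem_spechtSub_of_stabilizer_fixed {a b r : ℕ} {hr : r < a * b} (h1 : 1 ≤ r)
    (P : FoulkesPartition a b) {f : MonoidAlgebra ℂ (Tabloid (hookPartition (a * b) r hr))}
    (hf : f ∈ (spechtSub (hookPartition (a * b) r hr)).toSubmodule)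
    (hfix : ∀ k : Equiv.Perm (Fin (a * b)), k • P = P → youngPermRep _ k f = f) : f = 0 := by
  have hcoeff (k : Equiv.Perm (Fin (a * b))) (hk : k • P = P) (T) :
      f.coeff (k⁻¹ • T) = f.coeff T := by
    conv_rhs => rw [← hfix k hk]
    exact (Representation.coeff_ofMulAction k f T).symm
  suffices h : ∀ s : YTableau (hookPartition (a * b) r hr), f.coeff s.tabloid = 0 by
    ext T
    exact Quotient.inductionOn T h
  intro s
  obtain rfl | h2 := h1.eq_or_lt
  · have := Fintype.ofFinite (Tabloid (hookPartition (a * b) 1 hr))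
    have hconst (T) : f.coeff T = f.coeff s.tabloid := by
      refine Quotient.inductionOn T fun t => ?_
      change f.coeff t.tabloid = _
      obtain ⟨x, hx, -⟩ := exists_rowOf_eq s le_rfl
      obtain ⟨y, hy, -⟩ := exists_rowOf_eq t le_rfl
      obtain ⟨k, hk, hkx⟩ : ∃ k : Equiv.Perm (Fin (a * b)), k • P = P ∧ k x = y := by
        by_cases hxy : x = y
        · exact ⟨1, one_smul _ _, hxy⟩
        · obtain ⟨k, hk, hkx, -⟩ := P.exists_stabilizer_swap hxy
          exact ⟨k, hk, hkx⟩
      rw [← hcoeff k hk t.tabloid]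
      congr 1
      rw [YTableau.smul_tabloid, YTableau.tabloid_eq_iff]
      intro z
      rw [YTableau.rowOf_smul, inv_inv]
      have hs (z) : s.rowOf z = if z = x then 1 else 0 := by
        split_ifs with h
        · rw [h, hx]
        · have := rowOf_le s z
          by_contra h0
          exact h (eq_of_rowOf_eq s (by omega) (by omega))
      have ht (z) : t.rowOf z = if z = y then 1 else 0 := by
        split_ifs with h
        · rw [h, hy]
        · have := rowOf_le t z
          by_contra h0
          exact h (eq_of_rowOf_eq t (by omega) (by omega))
      rw [hs, ht, ← hkx]
      simp only [k.injective.eq_iff]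
    have hsum := sum_coeff_of_mem_spechtSub le_rfl hf
    have : Nonempty (Tabloid (hookPartition (a * b) 1 hr)) := ⟨s.tabloid⟩
    simpa [hconst] using hsum
  · obtain ⟨u, hu, -⟩ := exists_rowOf_eq s h1
    obtain ⟨v, hv, -⟩ := exists_rowOf_eq s h2
    obtain ⟨x, hx, y, hy, hxy, k, hk, hkz⟩ := P.exists_stabilizer_swap_fixing
      {z | 1 ≤ s.rowOf z} ⟨u, hu.ge, v, by simp [hv], by rintro rfl; omega⟩
    have hmove : k⁻¹ • s.tabloid = Equiv.swap x y • s.tabloid := by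
      rw [YTableau.smul_tabloid, YTableau.smul_tabloid, YTableau.tabloid_eq_iff]
      intro z
      rw [YTableau.rowOf_smul, YTableau.rowOf_smul, inv_inv, Equiv.swap_inv]
      by_cases hz : 1 ≤ s.rowOf z
      · rw [hkz z hz]
      · have hswap : Equiv.swap x y z = z :=
          Equiv.swap_apply_of_ne_of_ne (fun h => hz (h ▸ hx)) (fun h => hz (h ▸ hy))
        rw [hswap]
        -- `k` permutes the lower symbols among themselves, so by injectivity it keeps `z` in the
        -- first row.
        suffices ¬ 1 ≤ s.rowOf (k z) by omega
        intro hkz'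
        have hmem : 1 ≤ s.rowOf (Equiv.swap x y (k z)) := by
          rw [Equiv.swap_apply_def]
          split_ifs
          exacts [hy, hx, hkz']
        have := hkz _ hmem
        rw [Equiv.swap_apply_self] at this
        rw [k.injective this] at hmem
        exact hz hmem
    have h := hcoeff k hk s.tabloid
    rw [hmove, coeff_swap_of_mem_spechtSub hf s hxy hx hy] at h
    exact CharZero.neg_eq_self_iff.1 h

theorem eq_zero_of_stabilizer_fixed_spechtRep {a b r : ℕ} {hr : r < a * b} (h1 : 1 ≤ r)
    (P : FoulkesPartition a b) (w : (spechtSub (hookPartition (a * b) r hr)).toSubmodule)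
    (hfix : ∀ k : Equiv.Perm (Fin (a * b)), k • P = P → spechtRep _ k w = w) : w = 0 :=
  Subtype.ext (eq_zero_of_mem_spechtSub_of_stabilizer_fixed h1 P w.2 fun k hk =>
    congrArg Subtype.val (hfix k hk))

theorem theorem1p2 (a b r : ℕ) (hr : 1 ≤ r) (hrab : r < a * b) :
    charInner (foulkesCharacter a b) (spechtCharacter (hookPartition (a * b) r hrab)) = 0 ∧
      ¬ IsDirectSummand (spechtRep (hookPartition (a * b) r hrab)) (foulkesRep a b) := by
  have : Finite (FoulkesPartition a b) := inferInstanceAs (Finite (Subtype _))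
  exact ⟨charInner_ofMulAction_eq_zero _ (eq_zero_of_stabilizer_fixed_spechtRep hr),
    not_isDirectSummand_ofMulAction _ (eq_zero_of_stabilizer_fixed_spechtRep hr)⟩
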